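/- **Language.** Set terms are built from set variables, the constant $\varnothing$ and singletons $\{x\}$ ($x$ an individual variable) by $\cup,\cap,\setminus$ and a unary choice symbol $\mathtt c(\cdot)$. Atoms are $T_1=T_2$ and $T_1\subseteq T_2$ with $T_1,T_2$ set terms; BSTC-formulae are propositional combinations (with $\neg,\wedge,\vee,\Rightarrow,\Leftrightarrow$) of atoms. For a BSTC-formula $\varphi$ let $\mathrm{At}(\varphi)$ be the set of its atoms, $\mathcal T_\varphi$ the set of set terms occurring in $\varphi$ together with $\varnothing$, $V_0$ the set of individual variables occurring in $\varphi$, and $\mathtt c(T_1),\dots,\mathtt c(T_k)$ ($k\ge 0$) the distinct choice terms occurring in $\varphi$. The formula $\varphi$ is *choice-flat* if no $T_i$ contains the symbol $\mathtt c$, and *complete* if it contains as conjuncts the choice conditions $\varnothing\neq\mathtt c(T_i)\wedge \mathtt c(T_i)\subseteq T_i$ for all $i$ and the single-valuedness conditions $T_i=T_j\Rightarrow \mathtt c(T_i)=\mathtt c(T_j)$ for all distinct $i,j$. **Semantics.** A set assignment has a nonempty universe $U$; it interprets individual variables by elements of $U$, set variables by subsets of $U$, $\mathtt c$ by a total choice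 $c$ on $U$ (to each nonempty $B\subseteq U$ it assigns a nonempty $c(B)\subseteq B$), and everything else in the standard way. $\varphi$ is satisfiable under the WARP-semantics if it is true in some set assignment whose choice satisfies WARP: $A\subseteq B$ and $A\cap c(B)\ne\emptyset$ imply $c(A)=A\cap c(B)$. **Places.** A set $\mathcal A\subseteq \mathrm{At}(\varphi)$ is *promising* if making true exactly the atoms in $\mathcal A$ satisfies the propositional skeleton of $\varphi$. A *place* for $\varphi$ is a map $\pi:\mathcal T_\varphi\to\{0,1\}$ with $\pi(\varnothing)=0$, $\pi(S\cup T)=\pi(S)\vee\pi(T)$, $\pi(S\cap T)=\pi(S)\wedge\pi(T)$, $\pi(S\setminus T)=\pi(S)\wedge\neg\pi(T)$ for all terms of these forms in $\mathcal T_\varphi$; it is a *place at* $x\in V_0$ if $\pi(\{x\})=1$. For $\mathcal B\subseteq \mathrm{At}(\varphi)$, a set $\Pi$ of places is *$\mathcal B$-ample* if, for atoms of $\varphi$: for each atom $S=T$ (resp. $S\subseteq T$) not in $\mathcal B$, $\pi(S)=\pi(T)$ (resp. $\pi(S)\le\pi(T)$) for all $\pi\in\Pi$; and for each atom $S=T$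 (resp. $S\subseteq T$) in $\mathcal B$, $\pi(S)\ne\pi(T)$ (resp. $\pi(S)>\pi(T)$) for some $\pi\in\Pi$. For a set $\Pi$ of places put $\Pi_{\mathtt c}=\{\pi\in\Pi:\pi(T_i)=1\text{ or }\pi(\mathtt c(T_i))=1\text{ for some }i\}$, let $\pi\sim_{\mathtt c}\pi'$ mean that $\pi(T_i)=\pi'(T_i)$ and $\pi(\mathtt c(T_i))=\pi'(\mathtt c(T_i))$ for all $i$, and let $\mathcal P=\Pi_{\mathtt c}/{\sim_{\mathtt c}}$. For $\Pi'\in\mathcal P$ and $T\in\mathcal T_\varphi$, $\Pi'\subseteq T$ means that $\pi(T)=1$ for all $\pi\in\Pi'$, and $\Pi'$ *meets* $T$ if $\pi(T)=1$ for some $\pi\in\Pi'$. **Theorem.** Let $\varphi$ be a complete choice-flat BSTC-formula. Then $\varphi$ is satisfiable under the WARP-semantics if and only if there are a promising set $\mathcal A$ of atoms of $\varphi$, with complement $\mathcal A^-=\mathrm{At}(\varphi)\setminus\mathcal A$, and a set $\Pi$ of places for $\varphi$ such that (i) $\Pi$ is $\mathcal A^-$-ample and $|\Pi|\le|\mathcal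 A^-|+|V_0|+2^k$; (ii) there is a map $x\mapsto\pi^x$ from $V_0$ into $\Pi$ such that, for each $x\in V_0$, $\pi^x$ is the only place in $\Pi$ at $x$; (iii) there is a total Noetherian preorder $\precsim$ on $\mathcal P$ (reflexive, transitive, total, and every nonempty subset of $\mathcal P$ has a $\precsim$-maximal element, i.e. an element that has no element of the subset strictly above it) such that for all $\Pi',\Pi''\in\mathcal P$ and $i\in\{1,\dots,k\}$: (A′) if $\Pi'\subseteq T_i$ and $\Pi''\subseteq\mathtt c(T_i)$ then $\Pi'\precsim\Pi''$; (B′) if $\Pi'$ is $\precsim$-maximal in $\{\Pi^*\in\mathcal P:\Pi^*\text{ meets }T_i\}$, then $\Pi'\subseteq\mathtt c(T_i)$. -/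

import Mathlib

universe u

namespace BSTC

/-! ### Syntax -/

/-- Names of individual variables (a denumerable supply). -/
abbrev IndVar : Type := ℕ

/-- Names of set variables (a denumerable supply, disjoint from the individual variables because
the two kinds enter terms through different constructors). -/
abbrev SetVar : Type := ℕ

/-- Set terms: set variables, `∅`, `T₁ ∪ T₂`, `T₁ ∩ T₂`, `T₁ \ T₂`, `c(T)` and `{x}`. -/
inductive Term : Type
  | var (X : SetVar)
  | empty
  | union (T₁ T₂ : Term)
  | inter (T₁ T₂ : Term)
  | diff (T₁ T₂ : Term)
  | choice (T : Term)
  | single (x : IndVar)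
  deriving DecidableEq

/-- Atomic formulae: `T₁ = T₂` and `T₁ ⊆ T₂`. -/
inductive Atom : Type
  | eq (T₁ T₂ : Term)
  | sub (T₁ T₂ : Term)
  deriving DecidableEq

/-- Propositional combinations of elements of `α`. -/
inductive PropForm (α : Type) : Type
  | atom (a : α)
  | not (p : PropForm α)
  | and (p q : PropForm α)
  | or (p q : PropForm α)
  | imp (p q : PropForm α)
  | iff (p q : PropForm α)

/-- Truth value of a propositional combination under a valuation of its atoms. -/
def PropForm.Holds {α : Type} (v : α → Prop) : PropForm α → Prop
  | .atom a => v a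
  | .not p => ¬ p.Holds v
  | .and p q => p.Holds v ∧ q.Holds v
  | .or p q => p.Holds v ∨ q.Holds v
  | .imp p q => p.Holds v → q.Holds v
  | .iff p q => (p.Holds v ↔ q.Holds v)

/-- The atoms occurring in a propositional combination. -/
def PropForm.atoms {α : Type} [DecidableEq α] : PropForm α → Finset α
  | .atom a => {a}
  | .not p => p.atoms
  | .and p q => p.atoms ∪ q.atoms
  | .or p q => p.atoms ∪ q.atoms
  | .imp p q => p.atoms ∪ q.atoms
  | .iff p q => p.atoms ∪ q.atoms

/-- The conjuncts of a formula, once nested top-level conjunctions are flattened. -/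
def PropForm.conjuncts {α : Type} : PropForm α → Set (PropForm α)
  | .and p q => p.conjuncts ∪ q.conjuncts
  | p => {p}

/-- BSTC-formulae are the propositional combinations of atoms. Such a formula is at the same time
its own propositional skeleton, each distinct atom being read as a propositional variable. -/
abbrev Formula : Type := PropForm Atom

/-- All subterms of a set term, the term itself included. -/
def Term.subterms : Term → Finset Term
  | .var X => {.var X}
  | .empty => {.empty}
  | .union T₁ T₂ => insert (.union T₁ T₂) (T₁.subterms ∪ T₂.subterms)
  | .inter T₁ T₂ => insert (.inter T₁ T₂) (T₁.subterms ∪ T₂.subterms)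
  | .diff T₁ T₂ => insert (.diff T₁ T₂) (T₁.subterms ∪ T₂.subterms)
  | .choice T => insert (.choice T) T.subterms
  | .single x => {.single x}

/-- The individual variables occurring in a set term. -/
def Term.indVars : Term → Finset IndVar
  | .var _ => ∅
  | .empty => ∅
  | .union T₁ T₂ => T₁.indVars ∪ T₂.indVars
  | .inter T₁ T₂ => T₁.indVars ∪ T₂.indVars
  | .diff T₁ T₂ => T₁.indVars ∪ T₂.indVars
  | .choice T => T.indVars
  | .single x => {x}

/-- The term does not involve the choice symbol. -/
def Term.ChoiceFree : Term → Prop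
  | .var _ => True
  | .empty => True
  | .union T₁ T₂ => T₁.ChoiceFree ∧ T₂.ChoiceFree
  | .inter T₁ T₂ => T₁.ChoiceFree ∧ T₂.ChoiceFree
  | .diff T₁ T₂ => T₁.ChoiceFree ∧ T₂.ChoiceFree
  | .choice _ => False
  | .single _ => True

/-- Is the term of the form `c(T)`? -/
def Term.isChoice : Term → Bool
  | .choice _ => true
  | _ => false

/-- The set terms occurring in an atom. -/
def Atom.terms : Atom → Finset Term
  | .eq T₁ T₂ => T₁.subterms ∪ T₂.subterms
  | .sub T₁ T₂ => T₁.subterms ∪ T₂.subterms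

/-- `𝒯_φ`: the set terms occurring in `φ`, where `∅` is always included. -/
def terms (φ : Formula) : Finset Term :=
  insert Term.empty (φ.atoms.biUnion Atom.terms)

/-- `V₀`: the individual variables occurring in `φ`. -/
def indVars (φ : Formula) : Finset IndVar :=
  (terms φ).biUnion Term.indVars

/-- The distinct choice terms `c(T₁), …, c(T_k)` occurring in `φ`. -/
def choiceTerms (φ : Formula) : Finset Term :=
  (terms φ).filter (fun T => T.isChoice = true)

/-- `φ` is in choice-flat form: the argument of every choice term of `φ` is choice-free. -/
def ChoiceFlat (φ : Formula) : Prop :=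
  ∀ T : Term, Term.choice T ∈ choiceTerms φ → T.ChoiceFree

/-- `φ` is complete: its choice conditions `∅ ≠ c(T) ∧ c(T) ⊆ T` and its single-valuedness
conditions `S = T → c(S) = c(T)` are among its conjuncts. -/
def Complete (φ : Formula) : Prop :=
  (∀ T : Term, Term.choice T ∈ choiceTerms φ →
    PropForm.not (.atom (.eq .empty (.choice T))) ∈ φ.conjuncts ∧
    PropForm.atom (.sub (.choice T) T) ∈ φ.conjuncts) ∧
  (∀ S T : Term, Term.choice S ∈ choiceTerms φ → Term.choice T ∈ choiceTerms φ → S ≠ T →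
    PropForm.imp (.atom (.eq S T)) (.atom (.eq (.choice S) (.choice T))) ∈ φ.conjuncts)

/-! ### Semantics -/

/-- A total choice correspondence on `U`: to each nonempty `B ⊆ U` it assigns a nonempty subset of
`B`. It is coded as a map on all subsets of `U`; the value at `∅`, where a choice is not defined,
is then forced to be `∅`. -/
structure TotalChoice (U : Type u) where
  toFun : Set U → Set U
  subset : ∀ B : Set U, toFun B ⊆ B
  nonempty : ∀ B : Set U, B.Nonempty → (toFun B).Nonempty

/-- The weak axiom of revealed preference. -/
def TotalChoice.WARP {U : Type u} (c : TotalChoice U) : Prop :=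
  ∀ A B : Set U, A ⊆ B → (A ∩ c.toFun B).Nonempty → c.toFun A = A ∩ c.toFun B

/-- A set assignment with universe `U`. -/
structure SetAssignment (U : Type u) where
  ind : IndVar → U
  set : SetVar → Set U
  choice : TotalChoice U

/-- The value of a set term under a set assignment. -/
def SetAssignment.eval {U : Type u} (M : SetAssignment U) : Term → Set U
  | .var X => M.set X
  | .empty => ∅
  | .union T₁ T₂ => M.eval T₁ ∪ M.eval T₂
  | .inter T₁ T₂ => M.eval T₁ ∩ M.eval T₂
  | .diff T₁ T₂ => M.eval T₁ \ M.eval T₂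
  | .choice T => M.choice.toFun (M.eval T)
  | .single x => {M.ind x}

/-- Satisfaction of atoms. -/
def SetAssignment.SatAtom {U : Type u} (M : SetAssignment U) : Atom → Prop
  | .eq T₁ T₂ => M.eval T₁ = M.eval T₂
  | .sub T₁ T₂ => M.eval T₁ ⊆ M.eval T₂

/-- Satisfaction of formulae. -/
def SetAssignment.Sat {U : Type u} (M : SetAssignment U) (φ : Formula) : Prop :=
  φ.Holds M.SatAtom

/-- `φ` is satisfiable under the WARP-semantics (by a model whose nonempty universe lives in
`Type u`). -/
def WARPSatisfiable (φ : Formula) : Prop :=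
  ∃ (U : Type u) (_ : Nonempty U) (M : SetAssignment U), M.choice.WARP ∧ M.Sat φ

/-! ### Promising sets of atoms and places -/

/-- A set `A` of atoms of `φ` is promising for `φ`: making true exactly the atoms in `A` satisfies
the propositional skeleton of `φ`. -/
def Promising (φ : Formula) (A : Finset Atom) : Prop :=
  A ⊆ φ.atoms ∧ φ.Holds (fun a => a ∈ A)

/-- Boolean maps on `𝒯_φ`. -/
abbrev BoolMap (φ : Formula) : Type := {T : Term // T ∈ terms φ} → Bool

/-- A Boolean map on `𝒯_φ` is a place for `φ` if it respects `∅`, `∪`, `∩` and `\`. -/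
structure IsPlace (φ : Formula) (π : BoolMap φ) : Prop where
  empty : ∀ T : {T // T ∈ terms φ}, T.1 = .empty → π T = false
  union : ∀ T₁ T₂ T : {T // T ∈ terms φ}, T.1 = .union T₁.1 T₂.1 → π T = (π T₁ || π T₂)
  inter : ∀ T₁ T₂ T : {T // T ∈ terms φ}, T.1 = .inter T₁.1 T₂.1 → π T = (π T₁ && π T₂)
  diff : ∀ T₁ T₂ T : {T // T ∈ terms φ}, T.1 = .diff T₁.1 T₂.1 → π T = (π T₁ && !π T₂)

/-- `P` is an `A`-ample set of places for `φ`, where `A` is a set of atoms occurring in `φ`. -/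
structure IsAmple (φ : Formula) (A : Finset Atom) (P : Finset (BoolMap φ)) : Prop where
  place : ∀ π ∈ P, IsPlace φ π
  eq_of_notMem : ∀ T₁ T₂ : {T // T ∈ terms φ}, Atom.eq T₁.1 T₂.1 ∈ φ.atoms →
    Atom.eq T₁.1 T₂.1 ∉ A → ∀ π ∈ P, π T₁ = π T₂
  le_of_notMem : ∀ T₁ T₂ : {T // T ∈ terms φ}, Atom.sub T₁.1 T₂.1 ∈ φ.atoms →
    Atom.sub T₁.1 T₂.1 ∉ A → ∀ π ∈ P, π T₁ ≤ π T₂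
  ne_of_mem : ∀ T₁ T₂ : {T // T ∈ terms φ}, Atom.eq T₁.1 T₂.1 ∈ A → ∃ π ∈ P, π T₁ ≠ π T₂
  lt_of_mem : ∀ T₁ T₂ : {T // T ∈ terms φ}, Atom.sub T₁.1 T₂.1 ∈ A → ∃ π ∈ P, π T₂ < π T₁

/-- `π(T) = 1` at the term `{x}`: the place `π` is a place at the individual variable `x`. -/
def IsPlaceAt (φ : Formula) (x : IndVar) (π : BoolMap φ) : Prop :=
  ∃ T : {T // T ∈ terms φ}, T.1 = .single x ∧ π T = true

/-- The indices `1, …, k`: the pairs consisting of a choice term `c(T)` of `φ` and its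
argument `T`, both as elements of `𝒯_φ`. -/
structure ChoiceIndex (φ : Formula) where
  arg : {T // T ∈ terms φ}
  val : {T // T ∈ terms φ}
  val_eq : val.1 = .choice arg.1

/-- `Π_c`: the places in `P` that lie in `T_i` or in `c(T_i)` for some `i`. -/
def ChoicePlace (φ : Formula) (P : Finset (BoolMap φ)) : Type :=
  {π : BoolMap φ // π ∈ P ∧ ∃ i : ChoiceIndex φ, π i.arg = true ∨ π i.val = true}

/-- `∼_c`: the equivalence relation on `Π_c` given by agreement on all `T_i` and `c(T_i)`. -/
def choiceSetoid (φ : Formula) (P : Finset (BoolMap φ)) : Setoid (ChoicePlace φ P) where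
  r π π' := ∀ i : ChoiceIndex φ, π.1 i.arg = π'.1 i.arg ∧ π.1 i.val = π'.1 i.val
  iseqv :=
    { refl := fun _ _ => ⟨rfl, rfl⟩
      symm := fun h i => ⟨(h i).1.symm, (h i).2.symm⟩
      trans := fun h h' i => ⟨(h i).1.trans (h' i).1, (h i).2.trans (h' i).2⟩ }

/-- The quotient `Π_c / ∼_c`. -/
def ChoiceClass (φ : Formula) (P : Finset (BoolMap φ)) : Type :=
  Quotient (choiceSetoid φ P)

/-- The class `q` is contained in the term `T`: `π(T) = 1` for every `π` in `q`. -/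
def ChoiceClass.Sub {φ : Formula} {P : Finset (BoolMap φ)} (q : ChoiceClass φ P)
    (T : {T // T ∈ terms φ}) : Prop :=
  ∀ π : ChoicePlace φ P, Quotient.mk (choiceSetoid φ P) π = q → π.1 T = true

/-- The class `q` meets the term `T`: `π(T) = 1` for some `π` in `q`. -/
def ChoiceClass.Meets {φ : Formula} {P : Finset (BoolMap φ)} (q : ChoiceClass φ P)
    (T : {T // T ∈ terms φ}) : Prop :=
  ∃ π : ChoicePlace φ P, Quotient.mk (choiceSetoid φ P) π = q ∧ π.1 T = true

/-- `a` is an `r`-maximal element of `S`: no element of `S` is strictly `r`-above `a`. -/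
def IsMaximalIn {α : Type} (r : α → α → Prop) (S : Set α) (a : α) : Prop :=
  a ∈ S ∧ ¬ ∃ b ∈ S, r a b ∧ ¬ r b a

/-- `r` is a total Noetherian preorder. -/
structure IsTotalNoetherianPreorder {α : Type} (r : α → α → Prop) : Prop where
  refl : ∀ a, r a a
  trans : ∀ a b c, r a b → r b c → r a c
  total : ∀ a b, r a b ∨ r b a
  noetherian : ∀ S : Set α, S.Nonempty → ∃ a, IsMaximalIn r S a

/-- If `Π' ⊆ T_i` and `Π'' ⊆ c(T_i)`, then `Π' ≾ Π''`. -/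
def CondA {φ : Formula} {P : Finset (BoolMap φ)}
    (r : ChoiceClass φ P → ChoiceClass φ P → Prop) : Prop :=
  ∀ (q q' : ChoiceClass φ P) (i : ChoiceIndex φ), q.Sub i.arg → q'.Sub i.val → r q q'

/-- If `Π'` is `≾`-maximal among the classes meeting `T_i`, then `Π' ⊆ c(T_i)`. -/
def CondB {φ : Formula} {P : Finset (BoolMap φ)}
    (r : ChoiceClass φ P → ChoiceClass φ P → Prop) : Prop :=
  ∀ (q : ChoiceClass φ P) (i : ChoiceIndex φ),
    IsMaximalIn r {p | p.Meets i.arg} q → q.Sub i.val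

end BSTC

/-!
The argument rests on the fact that WARP-choices are maximisations of total preorders.

If `c` satisfies WARP, put `x ≾ y` when `y ∈ c({x, y})`. This is a total preorder
(`TotalChoice.WARP.rev_trans`, `TotalChoice.WARP.rev_total`) and `c(B)` is the set of `≾`-greatest
elements of `B` (`TotalChoice.WARP.rev_of_mem`, `TotalChoice.WARP.mem_of_rev`). Every point `u` of a
model induces the place `T ↦ [u ∈ T]` (`placeOf`). For `P` it is enough to take one such place for
each false atom, at a point refuting it, and the places of the individual variables; the bound
on the cardinality follows, even without the summand `2 ^ k`. Classes of places are compared through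
the points of chosen representatives. As `∅ ≠ c(T_i)` is a conjunct, `∅ = c(T_i)` is one of the false
atoms, so that `P` has a place in `c(T_i)`; this gives the condition on maximal elements.

Conversely, the places in `P`, and one additional point lying in no term of `φ`, form the universe
of a model (`canonicalModel`) in which the value of each term `T` of `φ` is `{π | π(T) = 1}`
(`mem_eval_canonicalModel`). The preorder on the classes lifts to the points, with the points outside
`Π_c` at the bottom, and the choice takes the greatest elements. `CondA` and `CondB` say
precisely that the greatest elements of the value of `T_i` are the places in `c(T_i)`
(`isGreatest_liftRel_iff`).
-/

namespace BSTC

/-! ### Formulae and their terms -/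

theorem PropForm.holds_congr {α : Type} [DecidableEq α] {v w : α → Prop} (p : PropForm α)
    (h : ∀ a ∈ p.atoms, (v a ↔ w a)) : p.Holds v ↔ p.Holds w := by
  induction p with
  | atom a => exact h a (by simp [PropForm.atoms])
  | not p ih => exact not_congr (ih h)
  | and p q ihp ihq =>
    exact and_congr (ihp fun a ha => h a (Finset.mem_union_left _ ha))
      (ihq fun a ha => h a (Finset.mem_union_right _ ha))
  | or p q ihp ihq =>
    exact or_congr (ihp fun a ha => h a (Finset.mem_union_left _ ha))
      (ihq fun a ha => h a (Finset.mem_union_right _ ha))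
  | imp p q ihp ihq =>
    exact imp_congr (ihp fun a ha => h a (Finset.mem_union_left _ ha))
      (ihq fun a ha => h a (Finset.mem_union_right _ ha))
  | iff p q ihp ihq =>
    exact iff_congr (ihp fun a ha => h a (Finset.mem_union_left _ ha))
      (ihq fun a ha => h a (Finset.mem_union_right _ ha))

theorem PropForm.holds_of_mem_conjuncts {α : Type} {v : α → Prop} {p q : PropForm α}
    (hq : q ∈ p.conjuncts) (hp : p.Holds v) : q.Holds v := by
  induction p with
  | and p₁ p₂ ih₁ ih₂ => exact hq.elim (fun h => ih₁ h hp.1) (fun h => ih₂ h hp.2)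
  | _ => obtain rfl : q = _ := hq; exact hp

theorem PropForm.atoms_subset_of_mem_conjuncts {α : Type} [DecidableEq α] {p q : PropForm α}
    (hq : q ∈ p.conjuncts) : q.atoms ⊆ p.atoms := by
  induction p with
  | and p₁ p₂ ih₁ ih₂ =>
    exact hq.elim (fun h => (ih₁ h).trans Finset.subset_union_left)
      (fun h => (ih₂ h).trans Finset.subset_union_right)
  | _ => obtain rfl : q = _ := hq; exact Finset.Subset.refl _

theorem Term.self_mem_subterms (T : Term) : T ∈ T.subterms := by
  cases T <;> simp [Term.subterms]

theorem Term.subterms_subset {S T : Term} (h : S ∈ T.subterms) : S.subterms ⊆ T.subterms := by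
  induction T with
  | var X => obtain rfl := Finset.mem_singleton.1 h; exact Finset.Subset.refl _
  | empty => obtain rfl := Finset.mem_singleton.1 h; exact Finset.Subset.refl _
  | single x => obtain rfl := Finset.mem_singleton.1 h; exact Finset.Subset.refl _
  | choice T ih =>
    rcases Finset.mem_insert.1 h with rfl | h
    · exact Finset.Subset.refl _
    · exact (ih h).trans (Finset.subset_insert _ _)
  | union T₁ T₂ ih₁ ih₂ | inter T₁ T₂ ih₁ ih₂ | diff T₁ T₂ ih₁ ih₂ =>
    rcases Finset.mem_insert.1 h with rfl | h
    · exact Finset.Subset.refl _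
    · refine Finset.Subset.trans ?_ (Finset.subset_insert _ _)
      rcases Finset.mem_union.1 h with h | h
      · exact (ih₁ h).trans Finset.subset_union_left
      · exact (ih₂ h).trans Finset.subset_union_right

theorem Term.single_mem_subterms {x : IndVar} {T : Term} (h : x ∈ T.indVars) :
    Term.single x ∈ T.subterms := by
  induction T with
  | var X => simp [Term.indVars] at h
  | empty => simp [Term.indVars] at h
  | single y => simpa [Term.indVars, Term.subterms] using h
  | choice T ih => exact Finset.mem_insert_of_mem (ih h)
  | union T₁ T₂ ih₁ ih₂ | inter T₁ T₂ ih₁ ih₂ | diff T₁ T₂ ih₁ ih₂ =>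
    exact Finset.mem_insert_of_mem ((Finset.mem_union.1 h).elim
      (fun h => Finset.mem_union_left _ (ih₁ h)) (fun h => Finset.mem_union_right _ (ih₂ h)))

theorem mem_terms_of_mem_subterms {φ : Formula} {S T : Term} (hT : T ∈ terms φ)
    (hS : S ∈ T.subterms) : S ∈ terms φ := by
  rcases Finset.mem_insert.1 hT with rfl | hT
  · obtain rfl := Finset.mem_singleton.1 hS
    exact Finset.mem_insert_self _ _
  · obtain ⟨a, ha, hT⟩ := Finset.mem_biUnion.1 hT
    refine Finset.mem_insert_of_mem (Finset.mem_biUnion.2 ⟨a, ha, ?_⟩)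
    cases a <;>
      exact Finset.mem_union.2 ((Finset.mem_union.1 hT).imp
        (fun h => Term.subterms_subset h hS) (fun h => Term.subterms_subset h hS))

theorem single_mem_terms {φ : Formula} {x : IndVar} (hx : x ∈ indVars φ) :
    Term.single x ∈ terms φ := by
  obtain ⟨T, hT, hxT⟩ := Finset.mem_biUnion.1 hx
  exact mem_terms_of_mem_subterms hT (Term.single_mem_subterms hxT)

theorem mem_indVars {φ : Formula} {x : IndVar} (hx : Term.single x ∈ terms φ) :
    x ∈ indVars φ :=
  Finset.mem_biUnion.2 ⟨_, hx, Finset.mem_singleton_self x⟩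

theorem mem_terms_of_eq_mem_atoms {φ : Formula} {S T : Term} (h : Atom.eq S T ∈ φ.atoms) :
    S ∈ terms φ ∧ T ∈ terms φ :=
  ⟨Finset.mem_insert_of_mem (Finset.mem_biUnion.2
      ⟨_, h, Finset.mem_union_left _ S.self_mem_subterms⟩),
    Finset.mem_insert_of_mem (Finset.mem_biUnion.2
      ⟨_, h, Finset.mem_union_right _ T.self_mem_subterms⟩)⟩

theorem mem_terms_of_sub_mem_atoms {φ : Formula} {S T : Term} (h : Atom.sub S T ∈ φ.atoms) :
    S ∈ terms φ ∧ T ∈ terms φ :=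
  ⟨Finset.mem_insert_of_mem (Finset.mem_biUnion.2
      ⟨_, h, Finset.mem_union_left _ S.self_mem_subterms⟩),
    Finset.mem_insert_of_mem (Finset.mem_biUnion.2
      ⟨_, h, Finset.mem_union_right _ T.self_mem_subterms⟩)⟩

/-! ### Choices and total preorders -/

/-- The revealed preference of a choice: `x` is at most as good as `y` if `y` is chosen
from `{x, y}`. -/
def TotalChoice.Rev {U : Type u} (c : TotalChoice U) (x y : U) : Prop :=
  y ∈ c.toFun {x, y}

theorem TotalChoice.WARP.rev_of_mem {U : Type u} {c : TotalChoice U} (hc : c.WARP) {B : Set U}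
    {x y : U} (hx : x ∈ B) (hy : y ∈ c.toFun B) : c.Rev x y := by
  have hsub : ({x, y} : Set U) ⊆ B :=
    Set.insert_subset hx (Set.singleton_subset_iff.2 (c.subset B hy))
  have hy' : y ∈ ({x, y} : Set U) ∩ c.toFun B := ⟨Or.inr rfl, hy⟩
  rw [TotalChoice.Rev, hc _ _ hsub ⟨y, hy'⟩]
  exact hy'

theorem TotalChoice.WARP.mem_of_rev {U : Type u} {c : TotalChoice U} (hc : c.WARP) {B : Set U}
    {x y : U} (hx : x ∈ c.toFun B) (hy : y ∈ B) (hxy : c.Rev x y) : y ∈ c.toFun B := by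
  have hsub : ({x, y} : Set U) ⊆ B :=
    Set.insert_subset (c.subset B hx) (Set.singleton_subset_iff.2 hy)
  rw [TotalChoice.Rev, hc _ _ hsub ⟨x, Or.inl rfl, hx⟩] at hxy
  exact hxy.2

theorem TotalChoice.WARP.rev_total {U : Type u} {c : TotalChoice U} (hc : c.WARP) (x y : U) :
    c.Rev x y ∨ c.Rev y x := by
  obtain ⟨z, hz⟩ := c.nonempty {x, y} ⟨x, Or.inl rfl⟩
  rcases c.subset _ hz with rfl | rfl
  · exact Or.inr (hc.rev_of_mem (Or.inr rfl) hz)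
  · exact Or.inl hz

theorem TotalChoice.WARP.rev_trans {U : Type u} {c : TotalChoice U} (hc : c.WARP) {x y z : U}
    (hxy : c.Rev x y) (hyz : c.Rev y z) : c.Rev x z := by
  have hz : z ∈ c.toFun {x, y, z} := by
    obtain ⟨w, hw⟩ := c.nonempty {x, y, z} ⟨x, Or.inl rfl⟩
    have hy : y ∈ c.toFun {x, y, z} → z ∈ c.toFun {x, y, z} := fun h =>
      hc.mem_of_rev h (by simp) hyz
    rcases c.subset _ hw with rfl | rfl | rfl
    · exact hy (hc.mem_of_rev hw (by simp) hxy)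
    · exact hy hw
    · exact hw
  exact hc.rev_of_mem (by simp) hz

/-- The total choice taking from each set its greatest elements with respect to a relation for which
every nonempty set has a greatest element. -/
def TotalChoice.ofRel {U : Type u} (s : U → U → Prop)
    (hs : ∀ B : Set U, B.Nonempty → ∃ x ∈ B, ∀ y ∈ B, s y x) : TotalChoice U where
  toFun B := {x | x ∈ B ∧ ∀ y ∈ B, s y x}
  subset _ _ h := h.1
  nonempty := hs

theorem TotalChoice.warp_ofRel {U : Type u} {s : U → U → Prop}
    (hs : ∀ B : Set U, B.Nonempty → ∃ x ∈ B, ∀ y ∈ B, s y x)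
    (htrans : ∀ x y z, s x y → s y z → s x z) : (TotalChoice.ofRel s hs).WARP := by
  rintro A B hAB ⟨x, hxA, hxB, hx⟩
  ext y
  constructor
  · rintro ⟨hyA, hy⟩
    exact ⟨hyA, hAB hyA, fun z hz => htrans _ _ _ (hx z hz) (hy x hxA)⟩
  · rintro ⟨hyA, -, hy⟩
    exact ⟨hyA, fun z hz => hy z (hAB hz)⟩

theorem IsTotalNoetherianPreorder.exists_greatest {α : Type} {r : α → α → Prop}
    (hr : IsTotalNoetherianPreorder r) {S : Set α} (hS : S.Nonempty) :
    ∃ a ∈ S, ∀ b ∈ S, r b a := by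
  obtain ⟨a, ha, hmax⟩ := hr.noetherian S hS
  refine ⟨a, ha, fun b hb => ?_⟩
  by_contra hba
  exact hmax ⟨b, hb, (hr.total a b).resolve_right hba, hba⟩

/-! ### Consequences of completeness -/

section Complete

variable {φ : Formula} {A : Finset Atom} {P : Finset (BoolMap φ)}

theorem ChoiceIndex.choice_mem_choiceTerms (i : ChoiceIndex φ) :
    Term.choice i.arg.1 ∈ choiceTerms φ :=
  Finset.mem_filter.2 ⟨i.val_eq ▸ i.val.2, rfl⟩

/-- The atom `∅ = c(T_i)` is false in every promising set, hence it has a witness in every ample set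
of places. -/
theorem exists_val_eq_true (hcomplete : Complete φ) (hA : Promising φ A)
    (hP : IsAmple φ (φ.atoms \ A) P) (i : ChoiceIndex φ) : ∃ π ∈ P, π i.val = true := by
  have hconj := (hcomplete.1 _ i.choice_mem_choiceTerms).1
  have hmem : Atom.eq .empty (.choice i.arg.1) ∈ φ.atoms :=
    PropForm.atoms_subset_of_mem_conjuncts hconj (Finset.mem_singleton_self _)
  have hnot : Atom.eq .empty (.choice i.arg.1) ∉ A :=
    PropForm.holds_of_mem_conjuncts hconj hA.2
  rw [← i.val_eq] at hmem hnot
  obtain ⟨π, hπ, hne⟩ := hP.ne_of_mem ⟨.empty, Finset.mem_insert_self _ _⟩ i.val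
    (Finset.mem_sdiff.2 ⟨hmem, hnot⟩)
  rw [(hP.place π hπ).empty _ rfl] at hne
  exact ⟨π, hπ, Bool.eq_true_of_not_eq_false hne.symm⟩

theorem arg_eq_true_of_val_eq_true (hcomplete : Complete φ) (hA : Promising φ A)
    (hP : IsAmple φ (φ.atoms \ A) P) (i : ChoiceIndex φ) {π : BoolMap φ} (hπ : π ∈ P)
    (h : π i.val = true) : π i.arg = true := by
  have hconj := (hcomplete.1 _ i.choice_mem_choiceTerms).2
  have hmem : Atom.sub (.choice i.arg.1) i.arg.1 ∈ φ.atoms :=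
    PropForm.atoms_subset_of_mem_conjuncts hconj (Finset.mem_singleton_self _)
  have hin : Atom.sub (.choice i.arg.1) i.arg.1 ∈ A :=
    PropForm.holds_of_mem_conjuncts hconj hA.2
  rw [← i.val_eq] at hmem hin
  have hle := hP.le_of_notMem i.val i.arg hmem (fun h => (Finset.mem_sdiff.1 h).2 hin) π hπ
  exact hle h

end Complete

/-! ### Classes of places -/

section Classes

variable {φ : Formula} {P : Finset (BoolMap φ)}

/-- The class of a choice place. -/
abbrev ChoicePlace.toClass (π : ChoicePlace φ P) : ChoiceClass φ P :=
  Quotient.mk (choiceSetoid φ P) π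

theorem ChoicePlace.toClass_sub_arg {π : ChoicePlace φ P} {i : ChoiceIndex φ} :
    π.toClass.Sub i.arg ↔ π.1 i.arg = true :=
  ⟨fun h => h π rfl, fun h _ hπ' => ((Quotient.exact hπ' i).1).trans h⟩

theorem ChoicePlace.toClass_sub_val {π : ChoicePlace φ P} {i : ChoiceIndex φ} :
    π.toClass.Sub i.val ↔ π.1 i.val = true :=
  ⟨fun h => h π rfl, fun h _ hπ' => ((Quotient.exact hπ' i).2).trans h⟩

theorem ChoicePlace.toClass_meets_arg {π : ChoicePlace φ P} {i : ChoiceIndex φ} :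
    π.toClass.Meets i.arg ↔ π.1 i.arg = true :=
  ⟨fun ⟨_, hπ', h⟩ => ((Quotient.exact hπ' i).1).symm.trans h, fun h => ⟨π, rfl, h⟩⟩

end Classes

/-! ### The places of a model -/

section PlacesOfModel

variable {U : Type u} (M : SetAssignment U) (φ : Formula)

open Classical in
/-- The place of a point of a model: the terms containing that point. -/
noncomputable def placeOf (u : U) : BoolMap φ :=
  fun T => decide (u ∈ M.eval T.1)

variable {M φ}

theorem placeOf_eq_true {u : U} {T : {T // T ∈ terms φ}} :
    placeOf M φ u T = true ↔ u ∈ M.eval T.1 := by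
  simp [placeOf]

theorem isPlace_placeOf (u : U) : IsPlace φ (placeOf M φ u) where
  empty T hT := by simp [placeOf, hT, SetAssignment.eval]
  union T₁ T₂ T hT := by
    have h : M.eval T.1 = M.eval T₁.1 ∪ M.eval T₂.1 := by rw [hT, SetAssignment.eval]
    rw [Bool.eq_iff_iff, placeOf_eq_true, h]
    simp [placeOf]
  inter T₁ T₂ T hT := by
    have h : M.eval T.1 = M.eval T₁.1 ∩ M.eval T₂.1 := by rw [hT, SetAssignment.eval]
    rw [Bool.eq_iff_iff, placeOf_eq_true, h]
    simp [placeOf]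
  diff T₁ T₂ T hT := by
    have h : M.eval T.1 = M.eval T₁.1 \ M.eval T₂.1 := by rw [hT, SetAssignment.eval]
    rw [Bool.eq_iff_iff, placeOf_eq_true, h]
    simp [placeOf]

/-- The point `u` refutes the atom `a`. -/
def SetAssignment.Refutes (M : SetAssignment U) (u : U) : Atom → Prop
  | .eq T₁ T₂ => ¬ (u ∈ M.eval T₁ ↔ u ∈ M.eval T₂)
  | .sub T₁ T₂ => u ∈ M.eval T₁ ∧ u ∉ M.eval T₂

theorem SetAssignment.exists_refutes {a : Atom} (h : ¬ M.SatAtom a) : ∃ u, M.Refutes u a := by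
  cases a with
  | eq T₁ T₂ =>
    by_contra! hne
    exact h (Set.ext fun u => not_not.1 (hne u))
  | sub T₁ T₂ => exact Set.not_subset.1 h

/-- The places of points of a model form an ample set as soon as every false atom is refuted by one
of these points. -/
theorem isAmple_of_refutes {A : Finset Atom} {P : Finset (BoolMap φ)}
    (hPM : ∀ π ∈ P, ∃ u, placeOf M φ u = π)
    (hsat : ∀ a ∈ φ.atoms, a ∉ A → M.SatAtom a)
    (href : ∀ a ∈ A, ∃ u, M.Refutes u a ∧ placeOf M φ u ∈ P) : IsAmple φ A P where
  place π hπ := by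
    obtain ⟨u, rfl⟩ := hPM π hπ
    exact isPlace_placeOf u
  eq_of_notMem T₁ T₂ ha hA π hπ := by
    obtain ⟨u, rfl⟩ := hPM π hπ
    have h : M.eval T₁.1 = M.eval T₂.1 := hsat _ ha hA
    simp [placeOf, h]
  le_of_notMem T₁ T₂ ha hA π hπ := by
    obtain ⟨u, rfl⟩ := hPM π hπ
    have h : M.eval T₁.1 ⊆ M.eval T₂.1 := hsat _ ha hA
    exact fun hu => placeOf_eq_true.2 (h (placeOf_eq_true.1 hu))
  ne_of_mem T₁ T₂ hA := by
    obtain ⟨u, hu, hP⟩ := href _ hA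
    exact ⟨_, hP, fun h => hu (by rw [← placeOf_eq_true, ← placeOf_eq_true, h])⟩
  lt_of_mem T₁ T₂ hA := by
    obtain ⟨u, ⟨h₁, h₂⟩, hP⟩ := href _ hA
    refine ⟨_, hP, ?_⟩
    rw [placeOf_eq_true.2 h₁, Bool.eq_false_of_not_eq_true (mt placeOf_eq_true.1 h₂)]
    exact Bool.false_lt_true

/-- The preorder is revealed preference between points representing the classes. For `CondB` it
matters that every `c(T_i)` contains a place of `P`. -/
theorem exists_preorder_of_model (hM : M.choice.WARP) {P : Finset (BoolMap φ)}
    (hPM : ∀ π ∈ P, ∃ u, placeOf M φ u = π)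
    (hval : ∀ i : ChoiceIndex φ, ∃ π ∈ P, π i.val = true) :
    ∃ r : ChoiceClass φ P → ChoiceClass φ P → Prop,
      IsTotalNoetherianPreorder r ∧ CondA r ∧ CondB r := by
  have hrep : ∀ q : ChoiceClass φ P, ∃ (π : ChoicePlace φ P) (u : U),
      π.toClass = q ∧ placeOf M φ u = π.1 := by
    intro q
    obtain ⟨π, rfl⟩ := Quotient.exists_rep q
    obtain ⟨u, hu⟩ := hPM π.1 π.2.1
    exact ⟨π, u, rfl, hu⟩
  choose f g hf hg using hrep
  have hfarg : ∀ q (i : ChoiceIndex φ), q.Sub i.arg ↔ g q ∈ M.eval i.arg.1 := by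
    intro q i
    rw [← placeOf_eq_true, hg, ← ChoicePlace.toClass_sub_arg, hf]
  have hfmeets : ∀ q (i : ChoiceIndex φ), q.Meets i.arg ↔ g q ∈ M.eval i.arg.1 := by
    intro q i
    rw [← placeOf_eq_true, hg, ← ChoicePlace.toClass_meets_arg, hf]
  have hfval : ∀ q (i : ChoiceIndex φ),
      q.Sub i.val ↔ g q ∈ M.choice.toFun (M.eval i.arg.1) := by
    intro q i
    have : M.eval i.val.1 = M.choice.toFun (M.eval i.arg.1) := by
      rw [i.val_eq, SetAssignment.eval]
    rw [← this, ← placeOf_eq_true, hg, ← ChoicePlace.toClass_sub_val, hf]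
  refine ⟨fun q q' => M.choice.Rev (g q) (g q'), ⟨fun q => ?_, fun _ _ _ => hM.rev_trans,
    fun _ _ => hM.rev_total _ _, fun S hS => ?_⟩, fun q q' i hq hq' => ?_, fun q i hq => ?_⟩
  · exact (hM.rev_total (g q) (g q)).elim id id
  · -- A class whose point is chosen among the points of all classes in `S` is maximal.
    obtain ⟨_, hu⟩ := M.choice.nonempty (g '' S) (hS.image g)
    obtain ⟨q, hq, rfl⟩ := M.choice.subset _ hu
    exact ⟨q, hq, fun ⟨b, hb, _, hbq⟩ => hbq (hM.rev_of_mem (Set.mem_image_of_mem g hb) hu)⟩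
  · exact hM.rev_of_mem ((hfarg q i).1 hq) ((hfval q' i).1 hq')
  · -- Compare `q` with the class of a place in `c(T_i)`, which is present in `P`.
    obtain ⟨π, hπP, hπ⟩ := hval i
    let p : ChoicePlace φ P := ⟨π, hπP, i, Or.inr hπ⟩
    have hp := (hfval p.toClass i).1 (ChoicePlace.toClass_sub_val.2 hπ)
    have hqarg := (hfmeets q i).1 hq.1
    refine (hfval q i).2 (hM.mem_of_rev hp hqarg ?_)
    by_contra hpq
    exact hq.2 ⟨p.toClass, (hfmeets _ i).2 (M.choice.subset _ hp), hM.rev_of_mem hqarg hp, hpq⟩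

end PlacesOfModel

/-! ### The model of a set of places -/

section Model

variable {φ : Formula} {A : Finset Atom} {P : Finset (BoolMap φ)}

/-- The universe of the model built from `P`: the places in `P` and an additional point `none`, which
keeps the universe nonempty and is to lie in no term of `φ`. -/
abbrev Points (P : Finset (BoolMap φ)) : Type u :=
  ULift.{u} (Option {π : BoolMap φ // π ∈ P})

/-- The point `u` lies in the term `T`, according to the place that `u` is. -/
def Points.Holds (u : Points.{u} P) (T : {T // T ∈ terms φ}) : Prop :=
  ∃ π, u.down = some π ∧ π.1 T = true

/-- The lift to the points of a relation on the classes; points outside `Π_c` are below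
everything. -/
def liftRel (r : ChoiceClass φ P → ChoiceClass φ P → Prop) (u v : Points.{u} P) : Prop :=
  ∀ π : ChoicePlace φ P, u.down = some ⟨π.1, π.2.1⟩ →
    ∃ π' : ChoicePlace φ P, v.down = some ⟨π'.1, π'.2.1⟩ ∧ r π.toClass π'.toClass

theorem liftRel_trans {r : ChoiceClass φ P → ChoiceClass φ P → Prop}
    (hr : IsTotalNoetherianPreorder r) (u v w : Points.{u} P) (huv : liftRel r u v)
    (hvw : liftRel r v w) : liftRel r u w := by
  intro π hπ
  obtain ⟨π', hπ', h⟩ := huv π hπ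
  obtain ⟨π'', hπ'', h'⟩ := hvw π' hπ'
  exact ⟨π'', hπ'', hr.trans _ _ _ h h'⟩

theorem exists_greatest_liftRel {r : ChoiceClass φ P → ChoiceClass φ P → Prop}
    (hr : IsTotalNoetherianPreorder r) (B : Set (Points.{u} P)) (hB : B.Nonempty) :
    ∃ u ∈ B, ∀ v ∈ B, liftRel r v u := by
  let S : Set (ChoiceClass φ P) :=
    {q | ∃ π : ChoicePlace φ P, π.toClass = q ∧ (⟨some ⟨π.1, π.2.1⟩⟩ : Points.{u} P) ∈ B}
  rcases S.eq_empty_or_nonempty with hS | hS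
  · obtain ⟨u, hu⟩ := hB
    refine ⟨u, hu, fun v hv π hπ => ?_⟩
    have : π.toClass ∈ S := ⟨π, rfl, by rwa [← hπ]⟩
    simp [hS] at this
  · obtain ⟨_, ⟨π, rfl, hπ⟩, hmax⟩ := hr.exists_greatest hS
    exact ⟨_, hπ, fun v hv π' hπ' => ⟨π, rfl, hmax _ ⟨π', rfl, by rwa [← hπ']⟩⟩⟩

/-- The greatest points of `T_i` are those in `c(T_i)`. -/
theorem isGreatest_liftRel_iff {r : ChoiceClass φ P → ChoiceClass φ P → Prop}
    (hcomplete : Complete φ) (hA : Promising φ A) (hP : IsAmple φ (φ.atoms \ A) P)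
    (hrA : CondA r) (hrB : CondB r) (i : ChoiceIndex φ) (u : Points.{u} P) :
    (u.Holds i.arg ∧ ∀ v : Points.{u} P, v.Holds i.arg → liftRel r v u) ↔ u.Holds i.val := by
  constructor
  · rintro ⟨⟨π, hu, hπ⟩, hmax⟩
    let p : ChoicePlace φ P := ⟨π.1, π.2, i, Or.inl hπ⟩
    refine ⟨π, hu, ChoicePlace.toClass_sub_val.1
      (hrB p.toClass i ⟨ChoicePlace.toClass_meets_arg.2 hπ, ?_⟩)⟩
    rintro ⟨_, ⟨b, rfl, hb⟩, -, hbp⟩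
    obtain ⟨p', hp', hrp'⟩ := hmax ⟨some ⟨b.1, b.2.1⟩⟩ ⟨_, rfl, hb⟩ b rfl
    have hpπ : p'.1 = π.1 := congrArg Subtype.val (Option.some.inj (hp'.symm.trans hu))
    have : p' = p := Subtype.ext hpπ
    exact hbp (this ▸ hrp')
  · rintro ⟨π, hu, hπ⟩
    refine ⟨⟨π, hu, arg_eq_true_of_val_eq_true hcomplete hA hP i π.2 hπ⟩, ?_⟩
    rintro v ⟨ρ, hv, hρ⟩ p hp
    have hpρ : p.1 = ρ.1 := congrArg Subtype.val (Option.some.inj (hp.symm.trans hv))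
    exact ⟨⟨π.1, π.2, i, Or.inr hπ⟩, hu, hrA _ _ i
      (ChoicePlace.toClass_sub_arg.2 (by rw [hpρ, hρ])) (ChoicePlace.toClass_sub_val.2 hπ)⟩

open Classical in
/-- The model on the points of `P`: individual variables denote their places, a set variable holds at
the places where it has value `1`, and the choice takes the greatest points. Variables not occurring
in `φ` get the values `none` and `∅`. -/
noncomputable def canonicalModel
    (p : {x : IndVar // x ∈ indVars φ} → {π : BoolMap φ // π ∈ P})
    {r : ChoiceClass φ P → ChoiceClass φ P → Prop} (hr : IsTotalNoetherianPreorder r) :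
    SetAssignment (Points.{u} P) where
  ind x := ⟨if hx : x ∈ indVars φ then some (p ⟨x, hx⟩) else none⟩
  set X := {u | ∃ h : Term.var X ∈ terms φ, u.Holds ⟨_, h⟩}
  choice := TotalChoice.ofRel (liftRel r) (exists_greatest_liftRel hr)

theorem mem_eval_canonicalModel (hcomplete : Complete φ) (hA : Promising φ A)
    (hP : IsAmple φ (φ.atoms \ A) P)
    {p : {x : IndVar // x ∈ indVars φ} → {π : BoolMap φ // π ∈ P}}
    (hp : ∀ x, IsPlaceAt φ x.1 (p x).1 ∧ ∀ π ∈ P, IsPlaceAt φ x.1 π → π = (p x).1)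
    {r : ChoiceClass φ P → ChoiceClass φ P → Prop} (hr : IsTotalNoetherianPreorder r)
    (hrA : CondA r) (hrB : CondB r) (T : Term) (hT : T ∈ terms φ) (u : Points.{u} P) :
    u ∈ (canonicalModel p hr).eval T ↔ u.Holds ⟨T, hT⟩ := by
  induction T generalizing u with
  | var X => exact ⟨fun ⟨_, h⟩ => h, fun h => ⟨hT, h⟩⟩
  | empty =>
    refine ⟨False.elim, ?_⟩
    rintro ⟨π, -, hπ⟩
    rw [(hP.place _ π.2).empty _ rfl] at hπ
    cases hπ
  | single x =>
    have hx : x ∈ indVars φ := mem_indVars hT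
    have hind : ((canonicalModel p hr).ind x : Points.{u} P) = ⟨some (p ⟨x, hx⟩)⟩ := by
      simp [canonicalModel, hx]
    rw [SetAssignment.eval, Set.mem_singleton_iff, hind]
    constructor
    · rintro rfl
      obtain ⟨⟨_, _⟩, rfl, h⟩ := (hp ⟨x, hx⟩).1
      exact ⟨_, rfl, h⟩
    · rintro ⟨π, hu, hπ⟩
      have : π = p ⟨x, hx⟩ := Subtype.ext ((hp ⟨x, hx⟩).2 π.1 π.2 ⟨_, rfl, hπ⟩)
      exact ULift.ext _ _ (hu.trans (congrArg some this))
  | choice T ih =>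
    have hT' : T ∈ terms φ := mem_terms_of_mem_subterms hT
      (Finset.mem_insert_of_mem T.self_mem_subterms)
    rw [← isGreatest_liftRel_iff hcomplete hA hP hrA hrB ⟨⟨T, hT'⟩, ⟨_, hT⟩, rfl⟩ u]
    exact and_congr (ih hT' u) (forall_congr' fun v => imp_congr (ih hT' v) Iff.rfl)
  | union T₁ T₂ ih₁ ih₂ =>
    have h₁ : T₁ ∈ terms φ := mem_terms_of_mem_subterms hT
      (Finset.mem_insert_of_mem (Finset.mem_union_left _ T₁.self_mem_subterms))
    have h₂ : T₂ ∈ terms φ := mem_terms_of_mem_subterms hT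
      (Finset.mem_insert_of_mem (Finset.mem_union_right _ T₂.self_mem_subterms))
    rw [SetAssignment.eval, Set.mem_union, ih₁ h₁, ih₂ h₂]
    have hπ : ∀ π : {π : BoolMap φ // π ∈ P}, _ := fun π =>
      (hP.place _ π.2).union ⟨T₁, h₁⟩ ⟨T₂, h₂⟩ ⟨_, hT⟩ rfl
    cases hu : u.down <;> simp [Points.Holds, hu, hπ]
  | inter T₁ T₂ ih₁ ih₂ =>
    have h₁ : T₁ ∈ terms φ := mem_terms_of_mem_subterms hT
      (Finset.mem_insert_of_mem (Finset.mem_union_left _ T₁.self_mem_subterms))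
    have h₂ : T₂ ∈ terms φ := mem_terms_of_mem_subterms hT
      (Finset.mem_insert_of_mem (Finset.mem_union_right _ T₂.self_mem_subterms))
    rw [SetAssignment.eval, Set.mem_inter_iff, ih₁ h₁, ih₂ h₂]
    have hπ : ∀ π : {π : BoolMap φ // π ∈ P}, _ := fun π =>
      (hP.place _ π.2).inter ⟨T₁, h₁⟩ ⟨T₂, h₂⟩ ⟨_, hT⟩ rfl
    cases hu : u.down <;> simp [Points.Holds, hu, hπ]
  | diff T₁ T₂ ih₁ ih₂ =>
    have h₁ : T₁ ∈ terms φ := mem_terms_of_mem_subterms hT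
      (Finset.mem_insert_of_mem (Finset.mem_union_left _ T₁.self_mem_subterms))
    have h₂ : T₂ ∈ terms φ := mem_terms_of_mem_subterms hT
      (Finset.mem_insert_of_mem (Finset.mem_union_right _ T₂.self_mem_subterms))
    rw [SetAssignment.eval, Set.mem_sdiff, ih₁ h₁, ih₂ h₂]
    have hπ : ∀ π : {π : BoolMap φ // π ∈ P}, _ := fun π =>
      (hP.place _ π.2).diff ⟨T₁, h₁⟩ ⟨T₂, h₂⟩ ⟨_, hT⟩ rfl
    cases hu : u.down <;> simp [Points.Holds, hu, hπ]

/-- If terms evaluate to the sets of their places, then an ample set of places makes exactly the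
atoms outside the given set true. -/
theorem satAtom_iff_of_isAmple {M : SetAssignment (Points.{u} P)}
    (hP : IsAmple φ (φ.atoms \ A) P)
    (hM : ∀ (T : Term) (hT : T ∈ terms φ) (u : Points.{u} P), u ∈ M.eval T ↔ u.Holds ⟨T, hT⟩)
    {a : Atom} (ha : a ∈ φ.atoms) : M.SatAtom a ↔ a ∈ A := by
  have hpoint : ∀ (π) (hπ : π ∈ P) (T) (hT : T ∈ terms φ),
      (⟨some ⟨π, hπ⟩⟩ : Points.{u} P) ∈ M.eval T ↔ π ⟨T, hT⟩ = true := by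
    intro π hπ T hT
    rw [hM T hT]
    simp [Points.Holds]
  cases a with
  | eq S T =>
    obtain ⟨hS, hT⟩ := mem_terms_of_eq_mem_atoms ha
    constructor
    · intro h
      by_contra hA'
      obtain ⟨π, hπ, hne⟩ := hP.ne_of_mem ⟨S, hS⟩ ⟨T, hT⟩ (Finset.mem_sdiff.2 ⟨ha, hA'⟩)
      refine hne (Bool.eq_iff_iff.2 ?_)
      rw [← hpoint π hπ, ← hpoint π hπ, show M.eval S = M.eval T from h]
    · intro h
      refine Set.ext fun u => ?_
      rw [hM S hS, hM T hT]
      refine exists_congr fun π => and_congr_right fun _ => ?_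
      rw [hP.eq_of_notMem ⟨S, hS⟩ ⟨T, hT⟩ ha (fun h' => (Finset.mem_sdiff.1 h').2 h) π.1 π.2]
  | sub S T =>
    obtain ⟨hS, hT⟩ := mem_terms_of_sub_mem_atoms ha
    constructor
    · intro h
      by_contra hA'
      obtain ⟨π, hπ, hlt⟩ := hP.lt_of_mem ⟨S, hS⟩ ⟨T, hT⟩ (Finset.mem_sdiff.2 ⟨ha, hA'⟩)
      refine hlt.not_ge fun hπS => ?_
      rw [← hpoint π hπ] at hπS ⊢
      exact h hπS
    · intro h u
      rw [hM S hS, hM T hT]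
      rintro ⟨π, hu, hπ⟩
      exact ⟨π, hu, hP.le_of_notMem ⟨S, hS⟩ ⟨T, hT⟩ ha
        (fun h' => (Finset.mem_sdiff.1 h').2 h) π.1 π.2 hπ⟩

end Model

end BSTC

open BSTC in
theorem mainTheorem8 (φ : BSTC.Formula) (hflat : BSTC.ChoiceFlat φ) (hcomplete : BSTC.Complete φ) :
    BSTC.WARPSatisfiable.{u} φ ↔
      ∃ (A : Finset BSTC.Atom) (P : Finset (BSTC.BoolMap φ)),
        BSTC.Promising φ A ∧
        BSTC.IsAmple φ (φ.atoms \ A) P ∧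
        P.card ≤ (φ.atoms \ A).card + (BSTC.indVars φ).card + 2 ^ (BSTC.choiceTerms φ).card ∧
        (∃ p : {x : BSTC.IndVar // x ∈ BSTC.indVars φ} → {π : BSTC.BoolMap φ // π ∈ P},
          ∀ x, BSTC.IsPlaceAt φ x.1 (p x).1 ∧
            ∀ π ∈ P, BSTC.IsPlaceAt φ x.1 π → π = (p x).1) ∧
        (∃ r : BSTC.ChoiceClass φ P → BSTC.ChoiceClass φ P → Prop,
          BSTC.IsTotalNoetherianPreorder r ∧ BSTC.CondA r ∧ BSTC.CondB r) := by
  classical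
  constructor
  · rintro ⟨U, hU, M, hM, hsat⟩
    let A : Finset Atom := φ.atoms.filter M.SatAtom
    have hA : Promising φ A :=
      ⟨Finset.filter_subset _ _, (PropForm.holds_congr φ fun a ha => by simp [A, ha]).1 hsat⟩
    -- A point refuting the given atom, if that atom is false.
    have hw : ∀ a, ∃ u, ¬ M.SatAtom a → M.Refutes u a := fun a =>
      if h : M.SatAtom a then ⟨Classical.arbitrary U, fun h' => absurd h h'⟩
      else (M.exists_refutes h).imp fun _ hu _ => hu
    choose w hw using hw
    let P : Finset (BoolMap φ) := (φ.atoms \ A).image (fun a => placeOf M φ (w a)) ∪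
      (indVars φ).image (fun x => placeOf M φ (M.ind x))
    have hPM : ∀ π ∈ P, ∃ u, placeOf M φ u = π := by
      intro π hπ
      rcases Finset.mem_union.1 hπ with h | h
      · obtain ⟨a, -, rfl⟩ := Finset.mem_image.1 h
        exact ⟨_, rfl⟩
      · obtain ⟨x, -, rfl⟩ := Finset.mem_image.1 h
        exact ⟨_, rfl⟩
    have hP : IsAmple φ (φ.atoms \ A) P := by
      refine isAmple_of_refutes hPM (fun a ha ha' => ?_) (fun a ha => ⟨w a, hw a ?_, ?_⟩)
      · by_contra h
        exact ha' (by simp [A, ha, h])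
      · intro h
        simp [A, h] at ha
      · exact Finset.mem_union_left _ (Finset.mem_image_of_mem _ ha)
    refine ⟨A, P, hA, hP, ?_, ⟨fun x => ⟨placeOf M φ (M.ind x.1),
      Finset.mem_union_right _ (Finset.mem_image_of_mem _ x.2)⟩, fun x => ⟨?_, ?_⟩⟩,
      exists_preorder_of_model hM hPM (exists_val_eq_true hcomplete hA hP)⟩
    · exact ((Finset.card_union_le _ _).trans
        (add_le_add Finset.card_image_le Finset.card_image_le)).trans (Nat.le_add_right _ _)
    · exact ⟨⟨_, single_mem_terms x.2⟩, rfl, placeOf_eq_true.2 rfl⟩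
    · rintro π hπ ⟨T, hT, hπT⟩
      obtain ⟨u, rfl⟩ := hPM π hπ
      have hu : u ∈ M.eval T.1 := placeOf_eq_true.1 hπT
      rw [hT] at hu
      exact congrArg (placeOf M φ) hu
  · rintro ⟨A, P, hA, hP, -, ⟨p, hp⟩, r, hr, hrA, hrB⟩
    refine ⟨Points P, ⟨⟨none⟩⟩, canonicalModel p hr,
      TotalChoice.warp_ofRel _ (liftRel_trans hr), ?_⟩
    exact (PropForm.holds_congr φ fun a ha => satAtom_iff_of_isAmple hP
      (mem_eval_canonicalModel hcomplete hA hP hp hr hrA hrB) ha).2 hA.2
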